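/- Let $P>0$, $\nu\in(0,1)$ and $P_{\mathrm{oe}}\in(0,1]$. Let $p(y|x)$ be a memoryless channel with real input and arbitrary (measurable) output alphabet $\mathcal Y$, and let $(\mathsf x_1,\mathsf y_1),(\mathsf x_2,\mathsf y_2),\dots$ be i.i.d. copies of $(\mathsf x,\mathsf y)$, where $\mathsf x\sim\mathcal N(0,P)$ and $\mathsf y$ is the channel output for the input $\mathsf x$. The training data set of length $L$ is $\mathcal T=\{(\mathsf x_1,\mathsf y_1),\dots,(\mathsf x_L,\mathsf y_L)\}$. Put $n=\lfloor\nu L\rfloor$ and split $\mathcal T$ into a learning part of length $L-n$ and a held-out part of length $n$. A learning rule produces, for every $L$ and measurably from the learning part only, a function $g_{\mathcal T}:\mathcal Y\to\mathbb R$ and a number $a_{\mathcal T}\in\mathbb R$. Below, $\mathbf E$, $\mathrm{var}$ and the expectations in the assumptions are taken over a fresh pair $(\mathsf x,\mathsf y)$ with $\mathsf x\sim\mathcal N(0,P)$, for fixed $g_{\mathcal T},a_{\mathcal T}$. For real $F,G$ put $$\Phi(F,G)=\sup_{\gamma\ge0}\Big\{\tfrac12\log(1+\gamma)-\tfrac{\gamma}{2}-\tfrac{\gamma^2}{1+\gamma}F+\gamma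 G\Big\}\in[0,+\infty],$$ and let $$I_{\mathrm{GMI},\mathcal T,A}=\Phi\Big(\frac{\mathbf E[g_{\mathcal T}(\mathsf y)^2]}{2a_{\mathcal T}^2P},\frac{\mathbf E[\mathsf x g_{\mathcal T}(\mathsf y)]}{a_{\mathcal T}P}\Big)$$ be the generalized mutual information (in nats) of the i.i.d. Gaussian codebook ensemble of power $P$ with nearest neighbor decoding based on $(g_{\mathcal T},a_{\mathcal T})$. With sums over the $n$ held-out samples, let $R_{\mathcal T}=\Phi(F_{\mathsf y},F_{\mathsf x\mathsf y})$, where $$F_{\mathsf y}=\frac1{2a_{\mathcal T}^2P}\Big[\frac1n\sum_i g_{\mathcal T}(\mathsf y_i)^2+\frac{\sqrt{2\,\overline{\mathrm{var}}(g_{\mathcal T}(\mathsf y)^2)}}{\sqrt n}\,\mathrm{erfc}^{-1}(P_{\mathrm{oe}})\Big],$$ $$F_{\mathsf x\mathsf y}=\frac1{a_{\mathcal T}P}\Big[\frac1n\sum_i \mathsf x_i g_{\mathcal T}(\mathsf y_i)-\mathrm{sgn}(a_{\mathcal T})\frac{\sqrt{2\,\overline{\mathrm{var}}(\mathsf x g_{\mathcal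 T}(\mathsf y))}}{\sqrt n}\,\mathrm{erfc}^{-1}(P_{\mathrm{oe}})\Big],$$ $\overline{\mathrm{var}}(U)=\frac1{n-1}\sum_i\big(U_i-\frac1n\sum_jU_j\big)^2$ is the empirical variance over the held-out samples, and $\mathrm{erfc}(x)=\frac{2}{\sqrt\pi}\int_x^\infty e^{-t^2}\,dt$. (If $a_{\mathcal T}=0$, the fractions are read as $0$, so that $R_{\mathcal T}=I_{\mathrm{GMI},\mathcal T,A}=0$.) Assume that the central limit theorem is applicable to the held-out samples, in the following sense: for every $L$, $\mathbf E[g_{\mathcal T}(\mathsf y)^4]<\infty$ almost surely; and for both $U=g_{\mathcal T}(\mathsf y)^2$ and $U=\mathsf x g_{\mathcal T}(\mathsf y)$ the Lindeberg condition holds in probability, i.e., for every $\varepsilon>0$, $$\frac{\mathbf E\big[(U-\mathbf E U)^2\,\mathbf 1\{|U-\mathbf E U|>\varepsilon\sqrt{n\,\mathrm{var}\,U}\}\big]}{\mathrm{var}\,U}\longrightarrow0\quad\text{in probability as }L\to\infty$$ (the ratio being read as $0$ if $\mathrm{var}\,U=0$). The Lindeberg condition holds automatically when $g_{\mathcal T}$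 is a fixed function with $\mathbf E[g_{\mathcal T}(\mathsf y)^4]<\infty$. Then $$\limsup_{L\to\infty}\Pr\big[R_{\mathcal T}>I_{\mathrm{GMI},\mathcal T,A}\big]\le P_{\mathrm{oe}}.$$ -/

import Mathlib

open MeasureTheory ProbabilityTheory Filter Topology
open scoped NNReal ENNReal

noncomputable section

/-- The complementary error function `erfc x = (2 / √π) ∫ₓ^∞ exp (-t²) dt`. -/
def erfc (x : ℝ) : ℝ := 2 / √Real.pi * ∫ t in Set.Ioi x, Real.exp (-t ^ 2)

/-- The inverse of `erfc`; `erfc` is a bijection from `ℝ` onto the interval `(0, 2)`, so this is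
the honest inverse there. -/
def erfcInv : ℝ → ℝ := Function.invFun erfc

/-- Empirical mean of `n` samples. -/
def sampleMean {n : ℕ} (u : Fin n → ℝ) : ℝ := (∑ i, u i) / n

/-- Empirical variance of `n` samples, with the normalization `1 / (n - 1)`. -/
def sampleVar {n : ℕ} (u : Fin n → ℝ) : ℝ := (∑ i, (u i - sampleMean u) ^ 2) / ((n : ℝ) - 1)

/-- The law of an input-output pair `(x, y)` with `x ∼ N(0, P)` and `y` drawn from the channel
`W(dy | x)`. -/
def pairLaw {Y : Type*} [MeasurableSpace Y] (P : ℝ≥0) (W : Kernel ℝ Y) : Measure (ℝ × Y) :=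
  gaussianReal 0 P ⊗ₘ W

/-- `sup_{γ ≥ 0} { ½ log (1 + γ) - γ/2 - γ²/(1 + γ) · Fy + γ · Fxy }`, as an extended real: the
supremum is `⊤` when the expression is unbounded. -/
def rateSup (Fy Fxy : ℝ) : EReal :=
  ⨆ γ : ℝ≥0, ((1 / 2 * Real.log (1 + γ) - γ / 2 - (γ : ℝ) ^ 2 / (1 + γ) * Fy + γ * Fxy : ℝ) : EReal)

/-- The GMI for the processing function `g` and the scaling parameter `a`, the expectations being
taken under `x ∼ N(0, P)`. For `a = 0` the fractions are `0` and the value is `0`, which is the GMI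
of a decoding metric that does not depend on the codeword. -/
def gmiA {Y : Type*} [MeasurableSpace Y] (P : ℝ≥0) (W : Kernel ℝ Y) (g : Y → ℝ) (a : ℝ) : EReal :=
  rateSup ((∫ z, g z.2 ^ 2 ∂pairLaw P W) / (2 * a ^ 2 * P))
    ((∫ z, z.1 * g z.2 ∂pairLaw P W) / (a * P))

/-- The biased estimate of `E[g(y)²] / (2 a² P)` from held-out samples `h`. -/
def estFy {Y : Type*} (P : ℝ≥0) (Poe : ℝ) (g : Y → ℝ) (a : ℝ) {n : ℕ} (h : Fin n → ℝ × Y) : ℝ :=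
  1 / (2 * a ^ 2 * P) *
    (sampleMean (fun i => g (h i).2 ^ 2) +
      √(2 * sampleVar (fun i => g (h i).2 ^ 2)) / √n * erfcInv Poe)

/-- The biased estimate of `E[x g(y)] / (a P)` from held-out samples `h`. -/
def estFxy {Y : Type*} (P : ℝ≥0) (Poe : ℝ) (g : Y → ℝ) (a : ℝ) {n : ℕ} (h : Fin n → ℝ × Y) : ℝ :=
  1 / (a * P) *
    (sampleMean (fun i => (h i).1 * g (h i).2) -
      Real.sign a * (√(2 * sampleVar (fun i => (h i).1 * g (h i).2)) / √n) * erfcInv Poe)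

/-- The code rate computed from the learnt pair `(g, a)` and the held-out samples `h`. -/
def estRate {Y : Type*} (P : ℝ≥0) (Poe : ℝ) (g : Y → ℝ) (a : ℝ) {n : ℕ} (h : Fin n → ℝ × Y) :
    EReal :=
  rateSup (estFy P Poe g a h) (estFxy P Poe g a h)

/-- Length of the held-out part of a data set of length `L`: `ν L`, rounded down. -/
def heldOutLen (ν : ℝ) (L : ℕ) : ℕ := ⌊ν * L⌋₊

/-- Length of the part of a data set of length `L` that is used for learning `g` and `a`. -/
def learnLen (ν : ℝ) (L : ℕ) : ℕ := L - heldOutLen ν L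

/-- The first `learnLen ν L` samples. -/
def learnPart {Y Ω : Type*} (ν : ℝ) (T : ℕ → Ω → ℝ × Y) (L : ℕ) (ω : Ω) :
    Fin (learnLen ν L) → ℝ × Y :=
  fun i => T i ω

/-- The remaining `heldOutLen ν L` samples among the first `L`. -/
def heldOutPart {Y Ω : Type*} (ν : ℝ) (T : ℕ → Ω → ℝ × Y) (L : ℕ) (ω : Ω) :
    Fin (heldOutLen ν L) → ℝ × Y :=
  fun i => T (learnLen ν L + i) ω

/-- A procedure which, for every data length `L`, learns a processing function and a scaling
parameter from the learning part of the data. -/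
structure Learner (Y : Type*) [MeasurableSpace Y] (ν : ℝ) where
  g : (L : ℕ) → (Fin (learnLen ν L) → ℝ × Y) → Y → ℝ
  a : (L : ℕ) → (Fin (learnLen ν L) → ℝ × Y) → ℝ
  measurable_g : ∀ L, Measurable (Function.uncurry (g L))
  measurable_a : ∀ L, Measurable (a L)

/-- The Lindeberg ratio `E[(U - m)² ; |U - m| > ε √n σ] / σ²` of a random variable `U` with mean `m`
and variance `σ²` under `ρ`, for samples of size `n`; it is `0` if `σ = 0`. -/
def lindebergRatio {S : Type*} [MeasurableSpace S] (ρ : Measure S) (U : S → ℝ) (n : ℕ) (ε : ℝ) :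
    ℝ :=
  (∫ s in {s | ε * √n * √(Var[U; ρ]) < |U s - ρ[U]|}, (U s - ρ[U]) ^ 2 ∂ρ) / Var[U; ρ]

end

/-!
Since `rateSup` is antitone in its first and monotone in its second argument, the estimated rate
can exceed the GMI only if one of two upper confidence bounds fails: the one for `E[g(y)²]`, or the
one for `-sgn(a) E[x g(y)]`. Conditionally on the learning part, `g` and `a` are fixed and the
held-out samples are i.i.d., so it is enough that each bound has asymptotic error `Poe / 2`.

As `g` varies with the data, this has to hold uniformly over the summand laws with a small Lindeberg
ratio. The uniformity is reduced to a limit theorem for arrays: Taylor expansion of the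
characteristic functions gives the Lindeberg central limit theorem for the normalized sums, and
truncating the squares shows that the sample variance asymptotically does not fall below the true
variance, so that the latter may be replaced by the former.
-/

theorem limsup_add_le_of_limsup_le {ι : Type*} {l : Filter ι} {u v : ι → ℝ≥0∞} {a b : ℝ≥0∞}
    (hu : limsup u l ≤ a) (hv : limsup v l ≤ b) : limsup (fun i => u i + v i) l ≤ a + b := by
  refine ENNReal.le_of_forall_pos_le_add fun δ hδ hab => ?_
  obtain ⟨ha, hb⟩ := ENNReal.add_lt_top.1 hab
  have hδ' : ((δ / 2 : ℝ≥0) : ℝ≥0∞) ≠ 0 := ENNReal.coe_ne_zero.2 (half_pos hδ).ne'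
  refine limsup_le_of_le (by isBoundedDefault) ?_
  filter_upwards [eventually_lt_of_limsup_lt (hu.trans_lt (ENNReal.lt_add_right ha.ne hδ')),
    eventually_lt_of_limsup_lt (hv.trans_lt (ENNReal.lt_add_right hb.ne hδ'))] with i hui hvi
  calc u i + v i ≤ a + (δ / 2 : ℝ≥0) + (b + (δ / 2 : ℝ≥0)) := add_le_add hui.le hvi.le
    _ = a + b + δ := by rw [add_add_add_comm, ← ENNReal.coe_add, add_halves]

theorem memLp_two_mul_of_memLp_four {S : Type*} [MeasurableSpace S] {ρ : Measure S} {U V : S → ℝ}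
    (hU : MemLp U 4 ρ) (hV : MemLp V 4 ρ) : MemLp (fun s => U s * V s) 2 ρ := by
  have : ENNReal.HolderTriple 4 4 2 := ⟨by
    rw [← two_mul, show (4 : ℝ≥0∞) = 2 * 2 by norm_num, ENNReal.mul_inv (by simp) (by simp),
      ← mul_assoc, ENNReal.mul_inv_cancel (by simp) (by simp), one_mul]⟩
  exact hV.mul' hU

theorem measurable_real_sign : Measurable Real.sign :=
  .ite measurableSet_Iio measurable_const (.ite measurableSet_Ioi measurable_const measurable_const)

theorem tendstoInMeasure_zero_of_nonneg_of_le {Ω ι : Type*} [MeasurableSpace Ω] {μ : Measure Ω}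
    {l : Filter ι} {f g : ι → Ω → ℝ} (hf : ∀ i ω, 0 ≤ f i ω) (hfg : ∀ i ω, f i ω ≤ g i ω)
    (hg : TendstoInMeasure μ g l fun _ => 0) : TendstoInMeasure μ f l fun _ => 0 := by
  rw [tendstoInMeasure_iff_norm] at hg ⊢
  refine fun ε hε => tendsto_of_tendsto_of_tendsto_of_le_of_le tendsto_const_nhds (hg ε hε)
    (fun _ => zero_le) fun i => measure_mono fun ω (hω : ε ≤ ‖f i ω - 0‖) => ?_
  rw [sub_zero] at hω
  rw [Set.mem_ofPred_eq, sub_zero]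
  exact hω.trans (abs_le_abs_of_nonneg (hf i ω) (hfg i ω))

/-! ### The complementary error function -/

theorem gaussianReal_Iic_neg_sqrt_two_mul (c : ℝ) :
    gaussianReal 0 1 (Set.Iic (-(√2 * c))) = ENNReal.ofReal (erfc c / 2) := by
  have h2 : (0 : ℝ) < √2 := by positivity
  have hpdf (x : ℝ) :
      gaussianPDFReal 0 1 (-(√2 * x)) = (√(2 * Real.pi))⁻¹ * Real.exp (-x ^ 2) := by
    simp only [gaussianPDFReal, NNReal.coe_one, mul_one, sub_zero, neg_sq, mul_pow,
      Real.sq_sqrt zero_le_two]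
    congr 2
    ring
  have hsubst := integral_comp_mul_left_Ioi (fun x => gaussianPDFReal 0 1 (-x)) c h2
  rw [smul_eq_mul, eq_comm, inv_mul_eq_iff_eq_mul₀ h2.ne'] at hsubst
  rw [gaussianReal_apply_eq_integral _ one_ne_zero, ← integral_comp_neg_Ioi, hsubst, erfc]
  simp_rw [hpdf]
  rw [integral_const_mul, Real.sqrt_mul zero_le_two]
  congr 1
  field_simp

theorem erfc_eq_one_sub (x : ℝ) :
    erfc x = 1 - 2 / √Real.pi * ∫ t in (0 : ℝ)..x, Real.exp (-t ^ 2) := by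
  have hint : Integrable fun t : ℝ => Real.exp (-t ^ 2) := by
    simpa using integrable_exp_neg_mul_sq one_pos
  have hhalf : ∫ t in Set.Ioi (0 : ℝ), Real.exp (-t ^ 2) = √Real.pi / 2 := by
    simpa using integral_gaussian_Ioi 1
  have hsplit := intervalIntegral.integral_interval_add_Ioi (a := 0) (b := x)
    hint.integrableOn hint.integrableOn
  have hpi : 0 < √Real.pi := Real.sqrt_pos.2 Real.pi_pos
  rw [hhalf] at hsplit
  rw [erfc, eq_sub_iff_add_eq'.2 hsplit]
  field_simp

theorem erfc_zero : erfc 0 = 1 := by simp [erfc_eq_one_sub]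

theorem continuous_erfc : Continuous erfc := by
  rw [funext erfc_eq_one_sub]
  exact continuous_const.sub (continuous_const.mul (intervalIntegral.continuous_primitive
    (fun _ _ => Continuous.intervalIntegrable (by fun_prop) _ _) 0))

theorem tendsto_erfc_atTop : Tendsto erfc atTop (𝓝 0) := by
  have htail := (tendsto_integral_Ioi_zero (f := fun t => Real.exp (-t ^ 2)) (μ := volume)
    tendsto_id).const_mul (2 / √Real.pi)
  rwa [mul_zero] at htail

theorem one_lt_erfc_of_neg {x : ℝ} (hx : x < 0) : 1 < erfc x := by
  have hint : 0 < ∫ t in x..(0 : ℝ), Real.exp (-t ^ 2) :=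
    intervalIntegral.intervalIntegral_pos_of_pos
      (Continuous.intervalIntegrable (by fun_prop) _ _) (fun _ => Real.exp_pos _) hx
  have hpi : 0 < 2 / √Real.pi := div_pos two_pos (Real.sqrt_pos.2 Real.pi_pos)
  rw [erfc_eq_one_sub, intervalIntegral.integral_symm]
  linarith [mul_pos hpi hint]

theorem erfc_erfcInv {p : ℝ} (hp0 : 0 < p) (hp1 : p ≤ 1) : erfc (erfcInv p) = p :=
  Function.invFun_eq (mem_range_of_exists_le_of_exists_ge continuous_erfc
    (tendsto_erfc_atTop.eventually_le_const hp0).exists ⟨0, by rwa [erfc_zero]⟩)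

theorem erfcInv_nonneg {p : ℝ} (hp0 : 0 < p) (hp1 : p ≤ 1) : 0 ≤ erfcInv p := by
  by_contra! h
  linarith [one_lt_erfc_of_neg h, erfc_erfcInv hp0 hp1]

/-! ### The Lindeberg central limit theorem for arrays with identically distributed rows -/

/-- A law on `ℝ` with mean `0` and variance `1`. -/
structure IsStandardized (κ : Measure ℝ) : Prop where
  memLp : MemLp id 2 κ
  integral_eq_zero : ∫ x, x ∂κ = 0
  integral_sq_eq_one : ∫ x, x ^ 2 ∂κ = 1

/-- The part of the second moment of `κ` that is contributed by values of modulus above `B`: the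
quantity in Lindeberg's condition. -/
noncomputable def tailSecondMoment (κ : Measure ℝ) (B : ℝ) : ℝ := ∫ x in {x | B < |x|}, x ^ 2 ∂κ

/-- The law of `(x₁ + ⋯ + xₙ) / √n` for independent samples `xᵢ` from `κ`. -/
noncomputable def normalizedSumLaw (κ : Measure ℝ) (n : ℕ) : Measure ℝ :=
  (Measure.pi fun _ : Fin n => κ).map fun p => (√n)⁻¹ * ∑ i, p i

instance isProbabilityMeasure_normalizedSumLaw (κ : Measure ℝ) [IsProbabilityMeasure κ] (n : ℕ) :
    IsProbabilityMeasure (normalizedSumLaw κ n) :=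
  Measure.isProbabilityMeasure_map (by fun_prop)

theorem measurableSet_lt_abs (B : ℝ) : MeasurableSet {x : ℝ | B < |x|} :=
  measurableSet_lt measurable_const measurable_id.abs

theorem tailSecondMoment_nonneg (κ : Measure ℝ) (B : ℝ) : 0 ≤ tailSecondMoment κ B :=
  integral_nonneg fun _ => sq_nonneg _

theorem tailSecondMoment_anti {κ : Measure ℝ} (hκ : MemLp id 2 κ) :
    Antitone (tailSecondMoment κ) := fun _ _ hB =>
  setIntegral_mono_set hκ.integrable_sq.integrableOn (ae_of_all _ fun _ => sq_nonneg _)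
    (LE.le.eventuallyLE fun _ hx => hB.trans_lt hx)

theorem norm_exp_mul_I_sub_taylor_le (x : ℝ) :
    ‖Complex.exp (x * Complex.I) - ((1 - x ^ 2 / 2 : ℝ) + x * Complex.I)‖ ≤
      4 * min (x ^ 2) (|x| ^ 3) := by
  rcases le_total |x| 1 with hx | hx
  · have htaylor : ∑ m ∈ Finset.range 3, (x * Complex.I : ℂ) ^ m / (m.factorial : ℂ) =
        (1 - x ^ 2 / 2 : ℝ) + x * Complex.I := by
      simp only [Finset.sum_range_succ, Finset.sum_range_zero, Nat.factorial, mul_pow, Complex.I_sq]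
      push_cast
      ring
    have hbound := Complex.exp_bound (x := x * Complex.I) (by simpa using hx) (n := 3) (by norm_num)
    have hcube : |x| ^ 3 ≤ x ^ 2 := by
      rw [← sq_abs x]
      exact pow_le_pow_of_le_one (abs_nonneg x) hx (by norm_num)
    rw [htaylor, norm_mul, Complex.norm_I, mul_one, Complex.norm_real, Real.norm_eq_abs] at hbound
    rw [min_eq_right hcube]
    norm_num [Nat.factorial] at hbound ⊢
    linarith [pow_nonneg (abs_nonneg x) 3]
  · have htriangle : ‖Complex.exp (x * Complex.I) - ((1 - x ^ 2 / 2 : ℝ) + x * Complex.I)‖ ≤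
        1 + (1 + x ^ 2 / 2 + |x|) := by
      refine (norm_sub_le _ _).trans (add_le_add (Complex.norm_exp_ofReal_mul_I x).le ?_)
      refine (norm_add_le _ _).trans (add_le_add ?_ (by simp))
      rw [Complex.norm_real]
      exact (norm_sub_le _ _).trans (by simp)
    have hcube : x ^ 2 ≤ |x| ^ 3 := by
      rw [← sq_abs x]
      exact pow_le_pow_right₀ hx (by norm_num)
    rw [min_eq_left hcube]
    nlinarith [sq_abs x]

theorem norm_pow_sub_pow_le {R : Type*} [SeminormedRing R] [NormOneClass R] {a b : R}
    (ha : ‖a‖ ≤ 1) (hb : ‖b‖ ≤ 1) (n : ℕ) : ‖a ^ n - b ^ n‖ ≤ n * ‖a - b‖ := by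
  induction n with
  | zero => simp
  | succ n ih =>
    calc ‖a ^ (n + 1) - b ^ (n + 1)‖ = ‖(a ^ n - b ^ n) * a + b ^ n * (a - b)‖ := by
          rw [pow_succ, pow_succ]
          noncomm_ring
      _ ≤ ‖a ^ n - b ^ n‖ * ‖a‖ + ‖b‖ ^ n * ‖a - b‖ :=
          (norm_add_le _ _).trans (add_le_add (norm_mul_le _ _)
            ((norm_mul_le _ _).trans (by gcongr; exact norm_pow_le b n)))
      _ ≤ n * ‖a - b‖ * 1 + 1 * ‖a - b‖ := by
          gcongr
          exact pow_le_one₀ (norm_nonneg b) hb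
      _ = (n + 1 : ℕ) * ‖a - b‖ := by push_cast; ring

section CharFun

variable {κ : Measure ℝ} [IsProbabilityMeasure κ]

theorem integrable_taylor (hκ : MemLp id 2 κ) (s : ℝ) :
    Integrable
      (fun x : ℝ => ((1 - (s * x) ^ 2 / 2 : ℝ) : ℂ) + ((s * x : ℝ) : ℂ) * Complex.I) κ := by
  have hid : Integrable (fun x : ℝ => s * x) κ := (hκ.integrable one_le_two).const_mul s
  have hsq : Integrable (fun x : ℝ => 1 - (s * x) ^ 2 / 2) κ :=
    (integrable_const 1).sub ((hκ.const_mul s).integrable_sq.div_const 2)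
  exact hsq.ofReal.add (hid.ofReal.mul_const _)

theorem IsStandardized.integral_taylor (hκ : IsStandardized κ) (s : ℝ) :
    ∫ x, (((1 - (s * x) ^ 2 / 2 : ℝ) : ℂ) + ((s * x : ℝ) : ℂ) * Complex.I) ∂κ =
      (1 - s ^ 2 / 2 : ℝ) := by
  have hid : Integrable (fun x : ℝ => s * x) κ := (hκ.memLp.integrable one_le_two).const_mul s
  have hsq : Integrable (fun x : ℝ => (s * x) ^ 2 / 2) κ :=
    (hκ.memLp.const_mul s).integrable_sq.div_const 2
  have hquad : ∫ x, (1 - (s * x) ^ 2 / 2) ∂κ = 1 - s ^ 2 / 2 := by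
    rw [integral_sub (integrable_const 1) hsq, integral_div]
    simp only [mul_pow, integral_const_mul, hκ.integral_sq_eq_one, integral_const, probReal_univ,
      smul_eq_mul, mul_one]
  rw [integral_add ((integrable_const 1).sub hsq).ofReal (hid.ofReal.mul_const _),
    integral_mul_const, integral_complex_ofReal, integral_complex_ofReal, hquad, integral_const_mul,
    hκ.integral_eq_zero]
  simp

theorem four_mul_min_sq_cube_le (s B x : ℝ) (hB : 0 ≤ B) :
    4 * min ((s * x) ^ 2) (|s * x| ^ 3) ≤
      4 * |s| ^ 3 * B * x ^ 2 + 4 * s ^ 2 * {y : ℝ | B < |y|}.indicator (fun y => y ^ 2) x := by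
  by_cases hx : B < |x|
  · rw [Set.indicator_of_mem (show x ∈ {y : ℝ | B < |y|} from hx)]
    have hnonneg : 0 ≤ 4 * |s| ^ 3 * B * x ^ 2 := by positivity
    linarith [min_le_left ((s * x) ^ 2) (|s * x| ^ 3), mul_pow s x 2]
  · rw [Set.indicator_of_notMem (show x ∉ {y : ℝ | B < |y|} from hx)]
    have hcube : |s * x| ^ 3 ≤ |s| ^ 3 * (B * x ^ 2) := by
      rw [abs_mul, mul_pow, pow_succ' |x|, sq_abs]
      gcongr
      exact not_lt.1 hx
    linarith [min_le_right ((s * x) ^ 2) (|s * x| ^ 3)]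

theorem IsStandardized.norm_charFun_sub_taylor_le (hκ : IsStandardized κ) (s : ℝ) {B : ℝ}
    (hB : 0 ≤ B) :
    ‖charFun κ s - (1 - s ^ 2 / 2 : ℝ)‖ ≤ 4 * |s| ^ 3 * B + 4 * s ^ 2 * tailSecondMoment κ B := by
  have hsq : Integrable (fun x : ℝ => x ^ 2) κ := hκ.memLp.integrable_sq
  have hexp : Integrable (fun x : ℝ => Complex.exp ((s * x : ℝ) * Complex.I)) κ :=
    .of_bound (by fun_prop) 1 (ae_of_all _ fun x => (Complex.norm_exp_ofReal_mul_I _).le)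
  have hdiff : charFun κ s - (1 - s ^ 2 / 2 : ℝ) = ∫ x, (Complex.exp ((s * x : ℝ) * Complex.I) -
      ((1 - (s * x) ^ 2 / 2 : ℝ) + (s * x : ℝ) * Complex.I)) ∂κ := by
    rw [integral_sub hexp (integrable_taylor hκ.memLp s), hκ.integral_taylor, charFun_apply_real]
    push_cast
    rfl
  have htail : Integrable ({y : ℝ | B < |y|}.indicator fun y => y ^ 2) κ :=
    hsq.indicator (measurableSet_lt_abs B)
  calc ‖charFun κ s - (1 - s ^ 2 / 2 : ℝ)‖
      ≤ ∫ x, (4 * |s| ^ 3 * B * x ^ 2 +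
          4 * s ^ 2 * {y : ℝ | B < |y|}.indicator (fun y => y ^ 2) x) ∂κ := by
        rw [hdiff]
        exact norm_integral_le_of_norm_le ((hsq.const_mul _).add (htail.const_mul _))
          (ae_of_all _ fun x => (norm_exp_mul_I_sub_taylor_le (s * x)).trans
            (four_mul_min_sq_cube_le s B x hB))
    _ = 4 * |s| ^ 3 * B + 4 * s ^ 2 * tailSecondMoment κ B := by
        rw [integral_add (hsq.const_mul _) (htail.const_mul _), integral_const_mul,
          integral_const_mul, hκ.integral_sq_eq_one, mul_one,
          integral_indicator (measurableSet_lt_abs B), tailSecondMoment]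

theorem charFun_normalizedSumLaw (n : ℕ) (t : ℝ) :
    charFun (normalizedSumLaw κ n) t = charFun κ ((√n)⁻¹ * t) ^ n := by
  rw [normalizedSumLaw, charFun_map_mul_comp (by fun_prop), charFun_map_sum_pi_eq_prod]
  simp

theorem IsStandardized.norm_charFun_normalizedSumLaw_sub_le (hκ : IsStandardized κ) {n : ℕ}
    (hn : 0 < n) {t ε : ℝ} (hε : 0 ≤ ε) (htn : t ^ 2 ≤ n) :
    ‖charFun (normalizedSumLaw κ n) t - (1 + (-t ^ 2 / 2 : ℂ) / n) ^ n‖ ≤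
      4 * |t| ^ 3 * ε + 4 * t ^ 2 * tailSecondMoment κ (ε * √n) := by
  have hn' : (0 : ℝ) < n := by exact_mod_cast hn
  have hsqrt : 0 < √(n : ℝ) := Real.sqrt_pos.2 hn'
  have hsq : ((√n)⁻¹ * t) ^ 2 = t ^ 2 / n := by
    rw [mul_pow, inv_pow, Real.sq_sqrt hn'.le, inv_mul_eq_div]
  have hbase : (1 + (-t ^ 2 / 2 : ℂ) / n) = (1 - ((√n)⁻¹ * t) ^ 2 / 2 : ℝ) := by
    rw [hsq]
    push_cast
    ring
  have hbase_le : ‖((1 - ((√n)⁻¹ * t) ^ 2 / 2 : ℝ) : ℂ)‖ ≤ 1 := by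
    have hratio : t ^ 2 / n ≤ 1 := (div_le_one hn').2 htn
    rw [Complex.norm_real, Real.norm_eq_abs, abs_le, hsq]
    constructor <;> linarith [div_nonneg (sq_nonneg t) hn'.le]
  rw [charFun_normalizedSumLaw, hbase]
  calc ‖charFun κ ((√n)⁻¹ * t) ^ n - ((1 - ((√n)⁻¹ * t) ^ 2 / 2 : ℝ) : ℂ) ^ n‖
      ≤ n * ‖charFun κ ((√n)⁻¹ * t) - (1 - ((√n)⁻¹ * t) ^ 2 / 2 : ℝ)‖ :=
        norm_pow_sub_pow_le (norm_charFun_le_one _) hbase_le n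
    _ ≤ n * (4 * |(√n)⁻¹ * t| ^ 3 * (ε * √n) +
          4 * ((√n)⁻¹ * t) ^ 2 * tailSecondMoment κ (ε * √n)) := by
        gcongr
        exact hκ.norm_charFun_sub_taylor_le _ (by positivity)
    _ = 4 * |t| ^ 3 * ε + 4 * t ^ 2 * tailSecondMoment κ (ε * √n) := by
        rw [hsq, abs_mul, abs_of_pos (inv_pos.2 hsqrt), mul_pow, inv_pow, pow_succ (√(n : ℝ)),
          Real.sq_sqrt hn'.le]
        field_simp

end CharFun

section Array

variable {κ : ℕ → Measure ℝ} [∀ k, IsProbabilityMeasure (κ k)] {N : ℕ → ℕ}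

theorem tendsto_charFun_normalizedSumLaw (hκ : ∀ k, IsStandardized (κ k))
    (hN : Tendsto N atTop atTop)
    (hlin : ∀ ε > 0, Tendsto (fun k => tailSecondMoment (κ k) (ε * √(N k))) atTop (𝓝 0)) (t : ℝ) :
    Tendsto (fun k => charFun (normalizedSumLaw (κ k) (N k)) t) atTop
      (𝓝 (Complex.exp (-t ^ 2 / 2))) := by
  have hexp := (Complex.tendsto_one_add_div_pow_exp (-t ^ 2 / 2)).comp hN
  have hN' : Tendsto (fun k => (N k : ℝ)) atTop atTop := tendsto_natCast_atTop_atTop.comp hN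
  refine (tendsto_iff_of_dist (Metric.tendsto_nhds.2 fun η hη => ?_)).2 hexp
  have hsmall : ∀ᶠ ε in 𝓝[>] (0 : ℝ), 4 * |t| ^ 3 * ε < η :=
    (((continuous_const_mul (4 * |t| ^ 3)).tendsto' 0 0 (mul_zero _)).eventually_lt_const
      hη).filter_mono nhdsWithin_le_nhds
  obtain ⟨ε, hεη, hε⟩ := (hsmall.and self_mem_nhdsWithin).exists
  have hbound : Tendsto (fun k => 4 * |t| ^ 3 * ε +
      4 * t ^ 2 * tailSecondMoment (κ k) (ε * √(N k))) atTop (𝓝 (4 * |t| ^ 3 * ε)) := by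
    simpa using ((hlin ε hε).const_mul (4 * t ^ 2)).const_add (4 * |t| ^ 3 * ε)
  filter_upwards [hbound.eventually_lt_const hεη, hN.eventually_gt_atTop 0,
    hN'.eventually_ge_atTop (t ^ 2)] with k hk hpos hsq
  rw [dist_zero_right, Real.norm_of_nonneg dist_nonneg, dist_eq_norm]
  exact ((hκ k).norm_charFun_normalizedSumLaw_sub_le hpos hε.le hsq).trans_lt hk

theorem tendsto_normalizedSumLaw (hκ : ∀ k, IsStandardized (κ k)) (hN : Tendsto N atTop atTop)
    (hlin : ∀ ε > 0, Tendsto (fun k => tailSecondMoment (κ k) (ε * √(N k))) atTop (𝓝 0)) :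
    Tendsto (β := ProbabilityMeasure ℝ) (fun k => ⟨normalizedSumLaw (κ k) (N k), inferInstance⟩)
      atTop (𝓝 ⟨gaussianReal 0 1, inferInstance⟩) := by
  refine ProbabilityMeasure.tendsto_iff_tendsto_charFun.2 fun t => ?_
  simpa [charFun_gaussianReal, neg_div] using tendsto_charFun_normalizedSumLaw hκ hN hlin t

theorem limsup_pi_normalized_sum_le (hκ : ∀ k, IsStandardized (κ k)) (hN : Tendsto N atTop atTop)
    (hlin : ∀ ε > 0, Tendsto (fun k => tailSecondMoment (κ k) (ε * √(N k))) atTop (𝓝 0)) (x : ℝ) :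
    limsup (fun k => (Measure.pi fun _ : Fin (N k) => κ k) {p | (√(N k))⁻¹ * ∑ i, p i ≤ x}) atTop ≤
      gaussianReal 0 1 (Set.Iic x) := by
  have hclosed := ProbabilityMeasure.limsup_measure_closed_le_of_tendsto
    (tendsto_normalizedSumLaw hκ hN hlin) (isClosed_Iic (a := x))
  refine (limsup_congr (.of_forall fun k => ?_)).trans_le hclosed
  rw [ProbabilityMeasure.coe_mk, normalizedSumLaw,
    Measure.map_apply (by fun_prop) measurableSet_Iic]
  rfl

end Array

/-! ### Concentration of the sample variance -/

section SampleMean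

variable {S : Type*} [MeasurableSpace S] {ρ : Measure S} [IsProbabilityMeasure ρ] {f : S → ℝ}

theorem memLp_comp_eval (hf : MemLp f 2 ρ) {n : ℕ} (i : Fin n) :
    MemLp (fun p : Fin n → S => f (p i)) 2 (Measure.pi fun _ => ρ) :=
  hf.comp_measurePreserving (measurePreserving_eval (fun _ => ρ) i)

theorem integral_sampleMean (hf : MemLp f 2 ρ) {n : ℕ} (hn : 0 < n) :
    ∫ p : Fin n → S, sampleMean (fun i => f (p i)) ∂(Measure.pi fun _ => ρ) = ρ[f] := by
  have hn' : (n : ℝ) ≠ 0 := by exact_mod_cast hn.ne'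
  simp only [sampleMean, integral_div]
  rw [integral_finsetSum _ fun i _ => (memLp_comp_eval hf i).integrable one_le_two]
  simp [integral_comp_eval (μ := fun _ : Fin n => ρ) hf.aestronglyMeasurable, hn']

theorem variance_sampleMean (hf : MemLp f 2 ρ) (n : ℕ) :
    Var[fun p : Fin n → S => sampleMean (fun i => f (p i)); Measure.pi fun _ => ρ] =
      Var[f; ρ] / n := by
  have hsum := variance_sum_pi (μ := fun _ : Fin n => ρ) (X := fun _ => f) fun _ => hf
  have hmean : (fun p : Fin n → S => sampleMean (fun i => f (p i))) =
      fun p => (n : ℝ)⁻¹ * (∑ i, fun p : Fin n → S => f (p i)) p := by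
    ext p
    rw [sampleMean, Finset.sum_apply, inv_mul_eq_div]
  rw [hmean, variance_const_mul, hsum, Finset.sum_const, Finset.card_univ, Fintype.card_fin,
    nsmul_eq_mul]
  rcases eq_or_ne (n : ℝ) 0 with hn | hn
  · simp [hn]
  · field_simp

theorem pi_le_abs_sampleMean_sub_le (hf : MemLp f 2 ρ) {n : ℕ} (hn : 0 < n) {c : ℝ} (hc : 0 < c) :
    (Measure.pi fun _ : Fin n => ρ) {p | c ≤ |sampleMean (fun i => f (p i)) - ρ[f]|} ≤
      ENNReal.ofReal (Var[f; ρ] / (n * c ^ 2)) := by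
  have hmem : MemLp (fun p : Fin n → S => sampleMean (fun i => f (p i))) 2
      (Measure.pi fun _ => ρ) := by
    simpa only [sampleMean, div_eq_inv_mul] using
      (memLp_finsetSum Finset.univ fun i _ => memLp_comp_eval hf i).const_mul (n : ℝ)⁻¹
  simpa only [integral_sampleMean hf hn, variance_sampleMean hf, div_div] using
    meas_ge_le_variance_div_sq hmem hc

end SampleMean

section SampleVar

variable {κ : Measure ℝ}

theorem integral_indicator_sq (hκ : MemLp id 2 κ) (B : ℝ) :
    ∫ x, {x : ℝ | B < |x|}ᶜ.indicator (fun x => x ^ 2) x ∂κ =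
      ∫ x, x ^ 2 ∂κ - tailSecondMoment κ B := by
  rw [integral_indicator (measurableSet_lt_abs B).compl, eq_sub_iff_add_eq', tailSecondMoment]
  exact integral_add_compl (measurableSet_lt_abs B) hκ.integrable_sq

theorem indicator_sq_sq_le (B x : ℝ) :
    {x : ℝ | B < |x|}ᶜ.indicator (fun x => x ^ 2) x ^ 2 ≤ B ^ 2 * x ^ 2 := by
  by_cases hx : B < |x|
  · rw [Set.indicator_of_notMem (by simpa using hx), zero_pow two_ne_zero]
    positivity
  · have hxB : x ^ 2 ≤ B ^ 2 := sq_le_sq.2 ((not_lt.1 hx).trans (le_abs_self B))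
    rw [Set.indicator_of_mem (by simpa using hx), sq (x ^ 2)]
    gcongr

theorem memLp_indicator_sq (hκ : MemLp id 2 κ) (B : ℝ) :
    MemLp ({x : ℝ | B < |x|}ᶜ.indicator fun x => x ^ 2) 2 κ := by
  have hmeas : Measurable ({x : ℝ | B < |x|}ᶜ.indicator fun x => x ^ 2) :=
    (measurable_id.pow_const 2).indicator (measurableSet_lt_abs B).compl
  refine (hκ.const_mul B).mono hmeas.aestronglyMeasurable (ae_of_all _ fun x => ?_)
  rw [Real.norm_eq_abs, Real.norm_eq_abs, ← sq_le_sq]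
  exact (indicator_sq_sq_le B x).trans_eq (mul_pow B x 2).symm

theorem variance_indicator_sq_le [IsProbabilityMeasure κ] (hκ : MemLp id 2 κ) (B : ℝ) :
    Var[{x : ℝ | B < |x|}ᶜ.indicator (fun x => x ^ 2); κ] ≤ B ^ 2 * ∫ x, x ^ 2 ∂κ := by
  have hmem := memLp_indicator_sq hκ B
  rw [← integral_const_mul]
  exact (variance_le_expectation_sq hmem.aestronglyMeasurable).trans
    (integral_mono hmem.integrable_sq (hκ.integrable_sq.const_mul _) (indicator_sq_sq_le B))

theorem pi_sampleMean_sq_le_le [IsProbabilityMeasure κ] (hκ : MemLp id 2 κ) {n : ℕ} (hn : 0 < n)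
    (B : ℝ) {η : ℝ} (hη : 0 < η) :
    (Measure.pi fun _ : Fin n => κ)
        {p | sampleMean (fun i => p i ^ 2) ≤ ∫ x, x ^ 2 ∂κ - tailSecondMoment κ B - η} ≤
      ENNReal.ofReal (B ^ 2 * (∫ x, x ^ 2 ∂κ) / (n * η ^ 2)) := by
  have hcheb := pi_le_abs_sampleMean_sub_le (memLp_indicator_sq hκ B) hn hη
  rw [integral_indicator_sq hκ] at hcheb
  refine (measure_mono fun p hp => ?_).trans (hcheb.trans (ENNReal.ofReal_le_ofReal ?_))
  · have htrunc : sampleMean (fun i => {x : ℝ | B < |x|}ᶜ.indicator (fun x => x ^ 2) (p i)) ≤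
        sampleMean fun i => p i ^ 2 := by
      unfold sampleMean
      gcongr
      exact Set.indicator_le_self' (fun _ _ => sq_nonneg _) _
    rw [Set.mem_ofPred_eq] at hp
    rw [Set.mem_ofPred_eq, le_abs']
    left
    linarith
  · gcongr
    exact variance_indicator_sq_le hκ B

theorem sum_sub_sampleMean_sq {n : ℕ} (u : Fin n → ℝ) :
    ∑ i, (u i - sampleMean u) ^ 2 = n * (sampleMean (fun i => u i ^ 2) - sampleMean u ^ 2) := by
  rcases Nat.eq_zero_or_pos n with rfl | hn
  · simp
  have hn' : (n : ℝ) ≠ 0 := by exact_mod_cast hn.ne'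
  have hsum (w : Fin n → ℝ) : ∑ i, w i = n * sampleMean w := by rw [sampleMean]; field_simp
  simp only [sub_sq, Finset.sum_add_distrib, Finset.sum_sub_distrib, mul_assoc, ← Finset.mul_sum,
    ← Finset.sum_mul, Finset.sum_const, Finset.card_univ, Fintype.card_fin, nsmul_eq_mul]
  rw [hsum u, hsum fun i => u i ^ 2]
  ring

theorem sampleMean_sq_sub_sq_sampleMean_le_sampleVar {n : ℕ} (u : Fin n → ℝ) :
    sampleMean (fun i => u i ^ 2) - sampleMean u ^ 2 ≤ sampleVar u := by
  rcases le_or_gt n 1 with hn | hn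
  · interval_cases n <;> simp [sampleMean, sampleVar]
  · have hn' : (1 : ℝ) < n := by exact_mod_cast hn
    have hnonneg : 0 ≤ ∑ i, (u i - sampleMean u) ^ 2 := Finset.sum_nonneg fun _ _ => sq_nonneg _
    rw [← mul_div_cancel_left₀ (sampleMean (fun i => u i ^ 2) - sampleMean u ^ 2)
      (zero_lt_one.trans hn').ne', ← sum_sub_sampleMean_sq, sampleVar]
    exact div_le_div_of_nonneg_left hnonneg (by linarith) (by linarith)

theorem IsStandardized.variance_id (hκ : IsStandardized κ) : Var[id; κ] = 1 := by
  rw [variance_of_integral_eq_zero aemeasurable_id hκ.integral_eq_zero]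
  exact hκ.integral_sq_eq_one

theorem IsStandardized.pi_sampleVar_lt_le [IsProbabilityMeasure κ] (hκ : IsStandardized κ) {n : ℕ}
    (hn : 0 < n) {ε η : ℝ} (hη : 0 < η) (htail : tailSecondMoment κ (ε * √n) ≤ η) :
    (Measure.pi fun _ : Fin n => κ) {p | sampleVar p < 1 - 3 * η} ≤
      ENNReal.ofReal (ε ^ 2 / η ^ 2 + 1 / (n * η)) := by
  have hn' : (0 : ℝ) < n := by exact_mod_cast hn
  have hsq := pi_sampleMean_sq_le_le hκ.memLp hn (ε * √n) hη
  have hmean := pi_le_abs_sampleMean_sub_le hκ.memLp hn (Real.sqrt_pos.2 hη)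
  rw [hκ.integral_sq_eq_one, mul_one, mul_pow, Real.sq_sqrt hn'.le, mul_comm (ε ^ 2),
    mul_div_mul_left _ _ hn'.ne'] at hsq
  rw [hκ.variance_id, Real.sq_sqrt hη.le] at hmean
  simp only [id, hκ.integral_eq_zero, sub_zero] at hmean
  rw [ENNReal.ofReal_add (by positivity) (by positivity)]
  refine (measure_mono fun p hp => ?_).trans ((measure_union_le _ _).trans (add_le_add hsq hmean))
  by_contra! hnot
  simp only [Set.mem_union, Set.mem_ofPred_eq, not_or, not_le] at hnot hp
  have hmean_sq : sampleMean p ^ 2 < η := by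
    simpa only [sq_abs, Real.sq_sqrt hη.le] using
      pow_lt_pow_left₀ hnot.2 (abs_nonneg _) two_ne_zero
  linarith [sampleMean_sq_sub_sq_sampleMean_le_sampleVar p, hnot.1]

end SampleVar

theorem tendsto_pi_sampleVar_lt {κ : ℕ → Measure ℝ} [∀ k, IsProbabilityMeasure (κ k)] {N : ℕ → ℕ}
    (hκ : ∀ k, IsStandardized (κ k)) (hN : Tendsto N atTop atTop)
    (hlin : ∀ ε > 0, Tendsto (fun k => tailSecondMoment (κ k) (ε * √(N k))) atTop (𝓝 0))
    {θ : ℝ} (hθ : θ < 1) :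
    Tendsto (fun k => (Measure.pi fun _ : Fin (N k) => κ k) {p | sampleVar p < θ}) atTop
      (𝓝 0) := by
  refine ENNReal.tendsto_nhds_zero.2 fun δ hδ => ?_
  obtain ⟨r, _, hr0, hrδ⟩ := ENNReal.lt_iff_exists_real_btwn.1 hδ
  obtain ⟨η, hη, rfl⟩ : ∃ η > 0, θ = 1 - 3 * η := ⟨(1 - θ) / 3, by linarith, by ring⟩
  have hr' : 0 < r := ENNReal.ofReal_pos.1 hr0
  have hε : 0 < η * √(r / 2) := by positivity
  have hinv : Tendsto (fun k => 1 / (N k * η)) atTop (𝓝 0) :=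
    ((tendsto_natCast_atTop_atTop.comp hN).atTop_mul_const hη).const_div_atTop 1
  filter_upwards [hN.eventually_gt_atTop 0, (hlin _ hε).eventually_le_const hη,
    hinv.eventually_le_const (half_pos hr')] with k hpos htail hle
  refine ((hκ k).pi_sampleVar_lt_le hpos hη htail).trans (le_trans ?_ hrδ.le)
  rw [mul_pow, Real.sq_sqrt (half_pos hr').le, mul_div_cancel_left₀ _ (by positivity)]
  exact ENNReal.ofReal_le_ofReal (by linarith)

/-! ### Studentized confidence bounds -/

/-- The upper confidence bound for a mean that is computed from the samples `u`. Its asymptotic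
error probability is `erfc c / 2`. -/
noncomputable def upperConfBound (c : ℝ) {n : ℕ} (u : Fin n → ℝ) : ℝ :=
  sampleMean u + √(2 * sampleVar u) / √n * c

theorem sampleMean_eq_inv_sqrt_mul {n : ℕ} (u : Fin n → ℝ) :
    sampleMean u = ((√n)⁻¹ * ∑ i, u i) / √n := by
  rw [inv_mul_eq_div, div_div, Real.mul_self_sqrt n.cast_nonneg, sampleMean]

theorem normalized_sum_le_of_upperConfBound_neg {c θ : ℝ} (hc : 0 ≤ c) {n : ℕ} {u : Fin n → ℝ}
    (hu : upperConfBound c u < 0) (hθ : θ ≤ sampleVar u) :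
    (√n)⁻¹ * ∑ i, u i ≤ -(√2 * (c * √θ)) := by
  have hdiv : ((√n)⁻¹ * ∑ i, u i + √2 * (c * √(sampleVar u))) / √n < 0 := by
    convert hu using 1
    rw [upperConfBound, sampleMean_eq_inv_sqrt_mul, Real.sqrt_mul zero_le_two]
    ring
  have hsum : (√n)⁻¹ * ∑ i, u i + √2 * (c * √(sampleVar u)) < 0 := by
    by_contra! hnonneg
    exact hdiv.not_ge (div_nonneg hnonneg (Real.sqrt_nonneg _))
  have hmono : √2 * (c * √θ) ≤ √2 * (c * √(sampleVar u)) := by gcongr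
  linarith

section Array

variable {κ : ℕ → Measure ℝ} [∀ k, IsProbabilityMeasure (κ k)] {N : ℕ → ℕ}

theorem limsup_pi_upperConfBound_neg_le_of_lt_one (hκ : ∀ k, IsStandardized (κ k))
    (hN : Tendsto N atTop atTop)
    (hlin : ∀ ε > 0, Tendsto (fun k => tailSecondMoment (κ k) (ε * √(N k))) atTop (𝓝 0))
    {c θ : ℝ} (hc : 0 ≤ c) (hθ : θ < 1) :
    limsup (fun k => (Measure.pi fun _ : Fin (N k) => κ k) {p | upperConfBound c p < 0}) atTop ≤
      ENNReal.ofReal (erfc (c * √θ) / 2) := by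
  have hunion (k : ℕ) : (Measure.pi fun _ : Fin (N k) => κ k) {p | upperConfBound c p < 0} ≤
      (Measure.pi fun _ : Fin (N k) => κ k) {p | (√(N k))⁻¹ * ∑ i, p i ≤ -(√2 * (c * √θ))} +
        (Measure.pi fun _ : Fin (N k) => κ k) {p | sampleVar p < θ} := by
    refine (measure_mono fun p hp => ?_).trans (measure_union_le _ _)
    exact (lt_or_ge (sampleVar p) θ).symm.imp_left (normalized_sum_le_of_upperConfBound_neg hc hp)
  rw [← gaussianReal_Iic_neg_sqrt_two_mul]
  exact (limsup_le_limsup (.of_forall hunion)).trans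
    ((ENNReal.limsup_add_of_right_tendsto_zero (tendsto_pi_sampleVar_lt hκ hN hlin hθ) _).trans_le
      (limsup_pi_normalized_sum_le hκ hN hlin _))

theorem limsup_pi_upperConfBound_neg_le (hκ : ∀ k, IsStandardized (κ k))
    (hN : Tendsto N atTop atTop)
    (hlin : ∀ ε > 0, Tendsto (fun k => tailSecondMoment (κ k) (ε * √(N k))) atTop (𝓝 0))
    {c : ℝ} (hc : 0 ≤ c) :
    limsup (fun k => (Measure.pi fun _ : Fin (N k) => κ k) {p | upperConfBound c p < 0}) atTop ≤
      ENNReal.ofReal (erfc c / 2) := by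
  have hcont : Continuous fun θ => ENNReal.ofReal (erfc (c * √θ) / 2) :=
    ENNReal.continuous_ofReal.comp
      ((continuous_erfc.comp (continuous_const.mul Real.continuous_sqrt)).div_const 2)
  have hlim : Tendsto (fun θ => ENNReal.ofReal (erfc (c * √θ) / 2)) (𝓝[<] 1)
      (𝓝 (ENNReal.ofReal (erfc c / 2))) :=
    (hcont.tendsto' 1 _ (by simp)).mono_left nhdsWithin_le_nhds
  refine ge_of_tendsto hlim ?_
  filter_upwards [self_mem_nhdsWithin] with θ hθ
  exact limsup_pi_upperConfBound_neg_le_of_lt_one hκ hN hlin hc hθ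

end Array

-- A failure of uniformity would yield an array contradicting the limit theorem.
theorem exists_forall_pi_upperConfBound_neg_le {c : ℝ} (hc : 0 ≤ c) {δ : ℝ} (hδ : 0 < δ) :
    ∃ ε > 0, ∃ n₀ : ℕ, ∀ n ≥ n₀, ∀ (κ : Measure ℝ) [IsProbabilityMeasure κ], IsStandardized κ →
      tailSecondMoment κ (ε * √n) ≤ ε →
      (Measure.pi fun _ : Fin n => κ) {p | upperConfBound c p < 0} ≤
        ENNReal.ofReal (erfc c / 2) + ENNReal.ofReal δ := by
  by_contra! hcon
  choose N hN κ hprob hκ htail hlarge using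
    fun k : ℕ => hcon (1 / (k + 1)) Nat.one_div_pos_of_nat k
  have hlin (ε : ℝ) (hε : 0 < ε) :
      Tendsto (fun k => tailSecondMoment (κ k) (ε * √(N k))) atTop (𝓝 0) := by
    refine squeeze_zero' (.of_forall fun k => tailSecondMoment_nonneg _ _) ?_
      tendsto_one_div_add_atTop_nhds_zero_nat
    filter_upwards [tendsto_one_div_add_atTop_nhds_zero_nat.eventually_le_const hε] with k hk
    exact (tailSecondMoment_anti (hκ k).memLp (by gcongr)).trans (htail k)
  have hlimsup := limsup_pi_upperConfBound_neg_le hκ (tendsto_atTop_mono hN tendsto_id) hlin hc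
  refine (hlimsup.trans_lt (ENNReal.lt_add_right ENNReal.ofReal_ne_top
    (ENNReal.ofReal_pos.2 hδ).ne')).not_ge ?_
  exact le_limsup_of_le (by isBoundedDefault) fun b hb =>
    let ⟨k, hk⟩ := hb.exists
    (hlarge k).le.trans hk

section Standardization

theorem sampleMean_sub_div {n : ℕ} (hn : 0 < n) (u : Fin n → ℝ) (m s : ℝ) :
    sampleMean (fun i => (u i - m) / s) = (sampleMean u - m) / s := by
  have hn' : (n : ℝ) ≠ 0 := by exact_mod_cast hn.ne'
  simp only [sampleMean, ← Finset.sum_div, Finset.sum_sub_distrib, Finset.sum_const,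
    Finset.card_univ, Fintype.card_fin, nsmul_eq_mul]
  rw [div_right_comm, sub_div, mul_div_cancel_left₀ _ hn']

theorem sampleVar_sub_div {n : ℕ} (hn : 0 < n) (u : Fin n → ℝ) (m s : ℝ) :
    sampleVar (fun i => (u i - m) / s) = sampleVar u / s ^ 2 := by
  simp only [sampleVar, sampleMean_sub_div hn, ← sub_div, sub_sub_sub_cancel_right, div_pow,
    ← Finset.sum_div]
  rw [div_right_comm]

theorem upperConfBound_sub_div {n : ℕ} (hn : 0 < n) (c : ℝ) (u : Fin n → ℝ) (m : ℝ) {s : ℝ}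
    (hs : 0 < s) :
    upperConfBound c (fun i => (u i - m) / s) = (upperConfBound c u - m) / s := by
  rw [upperConfBound, sampleMean_sub_div hn, sampleVar_sub_div hn, ← mul_div_assoc,
    Real.sqrt_div' _ (sq_nonneg s), Real.sqrt_sq hs.le, upperConfBound]
  ring

variable {S : Type*} [MeasurableSpace S] {ρ : Measure S} {U : S → ℝ}

/-- The law of `(U - m) / σ` under `ρ`, where `m` and `σ` are the mean and the standard deviation
of `U`. -/
noncomputable def standardizedLaw (ρ : Measure S) (U : S → ℝ) : Measure ℝ :=
  ρ.map fun s => (U s - ρ[U]) / √(Var[U; ρ])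

theorem lindebergRatio_eq_tailSecondMoment (hU : AEMeasurable U ρ) (hvar : 0 < Var[U; ρ]) (n : ℕ)
    (ε : ℝ) :
    lindebergRatio ρ U n ε = tailSecondMoment (standardizedLaw ρ U) (ε * √n) := by
  have hset : {s | ε * √n * √(Var[U; ρ]) < |U s - ρ[U]|} =
      (fun s => (U s - ρ[U]) / √(Var[U; ρ])) ⁻¹' {x : ℝ | ε * √n < |x|} := by
    ext s
    rw [Set.mem_preimage, Set.mem_ofPred_eq, Set.mem_ofPred_eq, abs_div,
      abs_of_pos (Real.sqrt_pos.2 hvar), lt_div_iff₀ (Real.sqrt_pos.2 hvar)]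
  rw [tailSecondMoment, standardizedLaw,
    setIntegral_map (measurableSet_lt_abs _) (by fun_prop) (by fun_prop), ← hset, lindebergRatio,
    ← integral_div]
  simp only [div_pow, Real.sq_sqrt hvar.le]

variable [IsProbabilityMeasure ρ]

theorem isProbabilityMeasure_standardizedLaw (hU : AEMeasurable U ρ) :
    IsProbabilityMeasure (standardizedLaw ρ U) :=
  Measure.isProbabilityMeasure_map (by fun_prop)

theorem isStandardized_standardizedLaw (hU : MemLp U 2 ρ) (hvar : 0 < Var[U; ρ]) :
    IsStandardized (standardizedLaw ρ U) where
  memLp := by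
    have hmap : MemLp (fun s => (U s - ρ[U]) / √(Var[U; ρ])) 2 ρ := by
      simpa only [div_eq_inv_mul, Pi.sub_apply] using (hU.sub (memLp_const _)).const_mul _
    exact (memLp_map_measure_iff aestronglyMeasurable_id hmap.aemeasurable).2 hmap
  integral_eq_zero := by
    have hint : Integrable U ρ := hU.integrable one_le_two
    rw [standardizedLaw, integral_map (by have := hU.aemeasurable; fun_prop) (by fun_prop),
      integral_div, integral_sub hint (integrable_const _)]
    simp
  integral_sq_eq_one := by
    rw [standardizedLaw, integral_map (by have := hU.aemeasurable; fun_prop) (by fun_prop)]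
    simp only [div_pow]
    rw [integral_div, ← variance_eq_integral hU.aemeasurable, Real.sq_sqrt hvar.le,
      div_self hvar.ne']

theorem pi_upperConfBound_lt_le_standardizedLaw (hU : AEMeasurable U ρ) (hvar : 0 < Var[U; ρ])
    {n : ℕ} (hn : 0 < n) (c : ℝ) :
    (Measure.pi fun _ : Fin n => ρ) {h | upperConfBound c (fun i => U (h i)) < ρ[U]} ≤
      (Measure.pi fun _ : Fin n => standardizedLaw ρ U) {p | upperConfBound c p < 0} := by
  have hstd : AEMeasurable (fun s => (U s - ρ[U]) / √(Var[U; ρ])) ρ := by fun_prop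
  have := isProbabilityMeasure_standardizedLaw hU
  have hpi : Measure.pi (fun _ : Fin n => standardizedLaw ρ U) =
      (Measure.pi fun _ : Fin n => ρ).map fun h i => (U (h i) - ρ[U]) / √(Var[U; ρ]) :=
    (Measure.pi_map_pi fun _ => hstd).symm
  rw [hpi]
  refine (measure_mono fun h hh => ?_).trans (Measure.le_map_apply ?_ _)
  · rw [Set.mem_preimage, Set.mem_ofPred_eq,
      upperConfBound_sub_div hn c (fun i => U (h i)) _ (Real.sqrt_pos.2 hvar)]
    exact div_neg_of_neg_of_pos (sub_neg.2 hh) (Real.sqrt_pos.2 hvar)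
  · exact aemeasurable_pi_lambda _ fun i =>
      hstd.comp_quasiMeasurePreserving (measurePreserving_eval _ i).quasiMeasurePreserving

theorem pi_upperConfBound_lt_eq_zero (hU : MemLp U 2 ρ) (hvar : Var[U; ρ] = 0) {n : ℕ} (hn : 0 < n)
    {c : ℝ} (hc : 0 ≤ c) :
    (Measure.pi fun _ : Fin n => ρ) {h | upperConfBound c (fun i => U (h i)) < ρ[U]} = 0 := by
  have hconst : ∀ᵐ h ∂(Measure.pi fun _ : Fin n => ρ), ∀ i, U (h i) = ρ[U] :=
    ae_all_iff.2 fun i => (measurePreserving_eval (fun _ : Fin n => ρ) i).quasiMeasurePreserving.ae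
      (ae_eq_integral_of_variance_eq_zero hU hvar)
  have hmean : sampleMean (fun _ : Fin n => ρ[U]) = ρ[U] := by
    simp [sampleMean, hn.ne']
  have hbound : ρ[U] ≤ upperConfBound c fun _ : Fin n => ρ[U] := by
    rw [upperConfBound, hmean]
    exact le_add_of_nonneg_right (by positivity)
  refine measure_mono_null ?_ (ae_iff.1 hconst)
  intro h hlt hall
  simp only [Set.mem_ofPred_eq, hall] at hlt
  exact hlt.not_ge hbound

theorem exists_forall_pi_upperConfBound_lt_le (ρ : Measure S) [IsProbabilityMeasure ρ] {c : ℝ}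
    (hc : 0 ≤ c) {δ : ℝ} (hδ : 0 < δ) :
    ∃ ε > 0, ∃ n₀ : ℕ, ∀ n ≥ n₀, ∀ U : S → ℝ, MemLp U 2 ρ → lindebergRatio ρ U n ε ≤ ε →
      (Measure.pi fun _ : Fin n => ρ) {h | upperConfBound c (fun i => U (h i)) < ρ[U]} ≤
        ENNReal.ofReal (erfc c / 2) + ENNReal.ofReal δ := by
  obtain ⟨ε, hε, n₀, hstd⟩ := exists_forall_pi_upperConfBound_neg_le hc hδ
  refine ⟨ε, hε, max n₀ 1, fun n hn U hU hlin => ?_⟩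
  have hn₀ : n₀ ≤ n := (le_max_left _ _).trans hn
  have hpos : 0 < n := (le_max_right _ _).trans hn
  rcases (variance_nonneg U ρ).eq_or_lt with hvar | hvar
  · simp only [pi_upperConfBound_lt_eq_zero hU hvar.symm hpos hc, zero_le]
  · have := isProbabilityMeasure_standardizedLaw hU.aemeasurable
    rw [lindebergRatio_eq_tailSecondMoment hU.aemeasurable hvar] at hlin
    exact (pi_upperConfBound_lt_le_standardizedLaw hU.aemeasurable hvar hpos c).trans
      (hstd n hn₀ _ (isStandardized_standardizedLaw hU hvar) hlin)

end Standardization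

/-! ### Conditioning on the learning part -/

section Conditioning

variable {Ω D E : Type*} [MeasurableSpace Ω] [MeasurableSpace D] [MeasurableSpace E]
  {μ : Measure Ω} {β : Measure E} {X : Ω → D} {H : Ω → E}
  {A : Set (D × E)}

theorem measure_prodMk_mem_eq_lintegral [IsFiniteMeasure μ] (hX : AEMeasurable X μ)
    (hH : HasLaw H β μ) (hindep : IndepFun X H μ) (hA : MeasurableSet A) :
    μ {ω | (X ω, H ω) ∈ A} = ∫⁻ ω, β (Prod.mk (X ω) ⁻¹' A) ∂μ := by
  have : IsFiniteMeasure β := hH.isFiniteMeasure_iff.1 inferInstance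
  have hjoint : μ.map (fun ω => (X ω, H ω)) = (μ.map X).prod β := by
    rw [hindep.map_prod_eq_prod_map_map hX hH.aemeasurable, hH.map_eq]
  calc μ {ω | (X ω, H ω) ∈ A}
      = (μ.map X).prod β A := by
        rw [← hjoint, Measure.map_apply_of_aemeasurable (hX.prodMk hH.aemeasurable) hA]
        rfl
    _ = ∫⁻ ω, β (Prod.mk (X ω) ⁻¹' A) ∂μ := by
        rw [Measure.prod_apply hA,
          lintegral_map' (measurable_measure_prodMk_left hA).aemeasurable hX]

theorem measure_prodMk_mem_le_add [IsProbabilityMeasure μ] (hX : AEMeasurable X μ)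
    (hH : HasLaw H β μ) (hindep : IndepFun X H μ) (hA : MeasurableSet A) {r : ℝ≥0∞} {B : Set Ω}
    (hr : ∀ᵐ ω ∂μ, ω ∉ B → β (Prod.mk (X ω) ⁻¹' A) ≤ r) :
    μ {ω | (X ω, H ω) ∈ A} ≤ r + μ B := by
  have : IsProbabilityMeasure β := hH.isProbabilityMeasure_iff.1 inferInstance
  have hle : ∀ᵐ ω ∂μ, β (Prod.mk (X ω) ⁻¹' A) ≤ r + B.indicator 1 ω := by
    filter_upwards [hr] with ω hω
    by_cases hB : ω ∈ B
    · rw [Set.indicator_of_mem hB]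
      exact prob_le_one.trans le_add_self
    · exact (hω hB).trans le_self_add
  calc μ {ω | (X ω, H ω) ∈ A}
      ≤ ∫⁻ ω, (r + B.indicator 1 ω) ∂μ :=
        (measure_prodMk_mem_eq_lintegral hX hH hindep hA).trans_le (lintegral_mono_ae hle)
    _ = r + ∫⁻ ω, B.indicator 1 ω ∂μ := by
        rw [lintegral_add_left measurable_const, lintegral_const, measure_univ, mul_one]
    _ ≤ r + μ B := by
        gcongr
        exact lintegral_indicator_one_le B

end Conditioning

theorem measurable_sampleMean {n : ℕ} : Measurable (sampleMean (n := n)) := by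
  unfold sampleMean
  fun_prop

theorem measurable_sampleVar {n : ℕ} : Measurable (sampleVar (n := n)) := by
  have := measurable_sampleMean (n := n)
  unfold sampleVar
  fun_prop

theorem measurable_upperConfBound (c : ℝ) {n : ℕ} : Measurable (upperConfBound c (n := n)) := by
  have := measurable_sampleMean (n := n)
  have := measurable_sampleVar (n := n)
  unfold upperConfBound
  fun_prop

theorem measurableSet_upperConfBound_lt {D S : Type*} [MeasurableSpace D] [MeasurableSpace S]
    (ρ : Measure S) [SFinite ρ] (c : ℝ) (n : ℕ) {U : D → S → ℝ}
    (hU : Measurable (Function.uncurry U)) :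
    MeasurableSet {q : D × (Fin n → S) | upperConfBound c (fun i => U q.1 (q.2 i)) < ρ[U q.1]} := by
  have hsamples : Measurable fun q : D × (Fin n → S) => fun i => U q.1 (q.2 i) :=
    measurable_pi_lambda _ fun i =>
      hU.comp (measurable_fst.prodMk ((measurable_pi_apply i).comp measurable_snd))
  have hmean : Measurable fun t => ρ[U t] := hU.stronglyMeasurable.integral_prod_right'.measurable
  exact measurableSet_lt ((measurable_upperConfBound c).comp hsamples) (hmean.comp measurable_fst)

section LearntStatistic

variable {Ω S : Type*} [MeasurableSpace Ω] [MeasurableSpace S] {μ : Measure Ω}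
  [IsProbabilityMeasure μ] {ρ : Measure S} [IsProbabilityMeasure ρ]

theorem limsup_measure_upperConfBound_lt_le {D : ℕ → Type*} [∀ L, MeasurableSpace (D L)]
    {n : ℕ → ℕ} (hn : Tendsto n atTop atTop)
    {X : ∀ L, Ω → D L} (hX : ∀ L, AEMeasurable (X L) μ)
    {H : ∀ L, Ω → Fin (n L) → S} (hH : ∀ L, HasLaw (H L) (Measure.pi fun _ => ρ) μ)
    (hindep : ∀ L, IndepFun (X L) (H L) μ)
    {U : ∀ L, D L → S → ℝ} (hU : ∀ L, Measurable (Function.uncurry (U L)))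
    (hmem : ∀ L, ∀ᵐ ω ∂μ, MemLp (U L (X L ω)) 2 ρ)
    (hlin : ∀ ε > 0, TendstoInMeasure μ
      (fun L ω => lindebergRatio ρ (U L (X L ω)) (n L) ε) atTop fun _ => 0)
    {c : ℝ} (hc : 0 ≤ c) :
    limsup (fun L => μ {ω | upperConfBound c (fun i => U L (X L ω) (H L ω i)) < ρ[U L (X L ω)]})
      atTop ≤ ENNReal.ofReal (erfc c / 2) := by
  refine ENNReal.le_of_forall_pos_le_add fun δ hδ _ => ?_
  have hδ' : (0 : ℝ) < (δ / 2 : ℝ≥0) := NNReal.coe_pos.2 (half_pos hδ)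
  obtain ⟨ε, hε, n₀, hbound⟩ := exists_forall_pi_upperConfBound_lt_le ρ hc hδ'
  have hexcept := (tendstoInMeasure_iff_norm.1 (hlin ε hε) ε hε).eventually_le_const
    (ENNReal.ofReal_pos.2 hδ')
  refine limsup_le_of_le (by isBoundedDefault) ?_
  filter_upwards [hexcept, hn.eventually_ge_atTop n₀] with L hL hnL
  have hcond : ∀ᵐ ω ∂μ, ω ∉ {ω | ε ≤ ‖lindebergRatio ρ (U L (X L ω)) (n L) ε - 0‖} →
      (Measure.pi fun _ : Fin (n L) => ρ)
        {h | upperConfBound c (fun i => U L (X L ω) (h i)) < ρ[U L (X L ω)]} ≤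
      ENNReal.ofReal (erfc c / 2) + ENNReal.ofReal (δ / 2 : ℝ≥0) := by
    filter_upwards [hmem L] with ω hω hratio
    rw [not_le, sub_zero] at hratio
    exact hbound (n L) hnL _ hω ((le_abs_self _).trans hratio.le)
  refine (measure_prodMk_mem_le_add (hX L) (hH L) (hindep L)
    (measurableSet_upperConfBound_lt ρ c (n L) (hU L)) hcond).trans ?_
  calc ENNReal.ofReal (erfc c / 2) + ENNReal.ofReal (δ / 2 : ℝ≥0) + μ _
      ≤ ENNReal.ofReal (erfc c / 2) + ENNReal.ofReal (δ / 2 : ℝ≥0) +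
          ENNReal.ofReal (δ / 2 : ℝ≥0) := by gcongr
    _ = ENNReal.ofReal (erfc c / 2) + δ := by
        rw [add_assoc, ENNReal.ofReal_coe_nnreal, ← ENNReal.coe_add, add_halves]

end LearntStatistic

section DataSplit

variable {Ω Y : Type*} [MeasurableSpace Ω] [MeasurableSpace Y] {μ : Measure Ω}
  {T : ℕ → Ω → ℝ × Y}

theorem aemeasurable_learnPart (hT : ∀ i, AEMeasurable (T i) μ) (ν : ℝ) (L : ℕ) :
    AEMeasurable (learnPart ν T L) μ :=
  aemeasurable_pi_lambda _ fun i => hT i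

theorem hasLaw_heldOutPart {ρ : Measure (ℝ × Y)} (hT : ∀ i, HasLaw (T i) ρ μ)
    (hindep : iIndepFun T μ) (ν : ℝ) (L : ℕ) :
    HasLaw (heldOutPart ν T L) (Measure.pi fun _ => ρ) μ :=
  (hindep.precomp ((add_right_injective (learnLen ν L)).comp Fin.val_injective)).hasLaw_pi
    fun _ => hT _

theorem indepFun_learnPart_heldOutPart (hT : ∀ i, AEMeasurable (T i) μ) (hindep : iIndepFun T μ)
    (ν : ℝ) (L : ℕ) : IndepFun (learnPart ν T L) (heldOutPart ν T L) μ := by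
  have hdisj : Disjoint (Finset.range (learnLen ν L))
      (Finset.Ico (learnLen ν L) (learnLen ν L + heldOutLen ν L)) := by
    rw [Finset.range_eq_Ico]
    exact Finset.Ico_disjoint_Ico_consecutive _ _ _
  exact (hindep.indepFun_finset₀ _ _ hdisj hT).comp
    (φ := fun u (i : Fin (learnLen ν L)) => u ⟨i, Finset.mem_range.2 i.2⟩)
    (ψ := fun u (i : Fin (heldOutLen ν L)) => u ⟨learnLen ν L + i, by simp⟩)
    (measurable_pi_lambda _ fun _ => measurable_pi_apply _)
    (measurable_pi_lambda _ fun _ => measurable_pi_apply _)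

theorem tendsto_heldOutLen {ν : ℝ} (hν : 0 < ν) : Tendsto (heldOutLen ν) atTop atTop :=
  tendsto_nat_floor_atTop.comp (tendsto_natCast_atTop_atTop.const_mul_atTop hν)

end DataSplit

/-! ### The estimated rate -/

theorem rateSup_mono {Fy Fy' Fxy Fxy' : ℝ} (hy : Fy' ≤ Fy) (hxy : Fxy ≤ Fxy') :
    rateSup Fy Fxy ≤ rateSup Fy' Fxy' := by
  refine iSup_mono fun γ => EReal.coe_le_coe_iff.2 ?_
  have hquad : (γ : ℝ) ^ 2 / (1 + γ) * Fy' ≤ (γ : ℝ) ^ 2 / (1 + γ) * Fy := by gcongr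
  have hlinear : (γ : ℝ) * Fxy ≤ γ * Fxy' := by gcongr
  linarith

theorem sampleMean_const_mul {n : ℕ} (r : ℝ) (u : Fin n → ℝ) :
    sampleMean (fun i => r * u i) = r * sampleMean u := by
  rw [sampleMean, ← Finset.mul_sum, mul_div_assoc, sampleMean]

theorem sampleVar_const_mul {n : ℕ} (r : ℝ) (u : Fin n → ℝ) :
    sampleVar (fun i => r * u i) = r ^ 2 * sampleVar u := by
  simp only [sampleVar, sampleMean_const_mul, ← mul_sub, mul_pow, ← Finset.mul_sum, mul_div_assoc]

theorem upperConfBound_const_mul {n : ℕ} (c r : ℝ) (u : Fin n → ℝ) :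
    upperConfBound c (fun i => r * u i) =
      r * sampleMean u + |r| * (√(2 * sampleVar u) / √n * c) := by
  rw [upperConfBound, sampleMean_const_mul, sampleVar_const_mul, mul_left_comm,
    Real.sqrt_mul (sq_nonneg r), Real.sqrt_sq_eq_abs]
  ring

section LindebergRatio

variable {S : Type*} [MeasurableSpace S]

theorem lindebergRatio_nonneg (ρ : Measure S) (U : S → ℝ) (n : ℕ) (ε : ℝ) :
    0 ≤ lindebergRatio ρ U n ε :=
  div_nonneg (integral_nonneg fun _ => sq_nonneg _) (variance_nonneg _ _)

theorem lindebergRatio_const_mul (ρ : Measure S) {r : ℝ} (hr : r ≠ 0) (U : S → ℝ) (n : ℕ) (ε : ℝ) :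
    lindebergRatio ρ (fun s => r * U s) n ε = lindebergRatio ρ U n ε := by
  have hset : {s | ε * √n * (|r| * √(Var[U; ρ])) < |r| * |U s - ρ[U]|} =
      {s | ε * √n * √(Var[U; ρ]) < |U s - ρ[U]|} := by
    simp only [mul_left_comm (ε * √n), mul_lt_mul_iff_right₀ (abs_pos.2 hr)]
  simp only [lindebergRatio, variance_const_mul, integral_const_mul, ← mul_sub, abs_mul, mul_pow,
    Real.sqrt_mul (sq_nonneg r), Real.sqrt_sq_eq_abs, hset]
  exact mul_div_mul_left _ _ (pow_ne_zero 2 hr)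

theorem lindebergRatio_const_mul_le (ρ : Measure S) (r : ℝ) (U : S → ℝ) (n : ℕ) (ε : ℝ) :
    lindebergRatio ρ (fun s => r * U s) n ε ≤ lindebergRatio ρ U n ε := by
  rcases eq_or_ne r 0 with rfl | hr
  · simpa [lindebergRatio] using lindebergRatio_nonneg ρ U n ε
  · exact (lindebergRatio_const_mul ρ hr U n ε).le

end LindebergRatio

section Channel

variable {Y : Type*} [MeasurableSpace Y] (P : ℝ≥0) (W : Kernel ℝ Y)

theorem upperConfBound_lt_of_gmiA_lt_estRate (Poe : ℝ) (g : Y → ℝ) (a : ℝ) {n : ℕ}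
    (h : Fin n → ℝ × Y) (hlt : gmiA P W g a < estRate P Poe g a h) :
    upperConfBound (erfcInv Poe) (fun i => g (h i).2 ^ 2) < ∫ z, g z.2 ^ 2 ∂pairLaw P W ∨
      upperConfBound (erfcInv Poe) (fun i => -Real.sign a * ((h i).1 * g (h i).2)) <
        ∫ z, -Real.sign a * (z.1 * g z.2) ∂pairLaw P W := by
  contrapose! hlt
  obtain ⟨hy, hxy⟩ := hlt
  refine rateSup_mono ?_ ?_
  · rw [estFy, one_div, div_eq_inv_mul]
    exact mul_le_mul_of_nonneg_left hy (by positivity)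
  · rw [upperConfBound_const_mul, integral_const_mul] at hxy
    rw [estFxy, one_div, div_eq_inv_mul (∫ z, z.1 * g z.2 ∂pairLaw P W)]
    rcases lt_trichotomy a 0 with ha | rfl | ha
    · rw [Real.sign_of_neg ha, neg_neg, abs_one] at hxy
      rw [Real.sign_of_neg ha]
      refine mul_le_mul_of_nonpos_left (by linarith) (inv_nonpos.2 ?_)
      exact mul_nonpos_of_nonpos_of_nonneg ha.le P.2
    · simp
    · rw [Real.sign_of_pos ha, abs_neg, abs_one] at hxy
      rw [Real.sign_of_pos ha]
      exact mul_le_mul_of_nonneg_left (by linarith) (by positivity)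

variable [IsMarkovKernel W]

instance isProbabilityMeasure_pairLaw : IsProbabilityMeasure (pairLaw P W) := by
  unfold pairLaw
  infer_instance

theorem memLp_fst_pairLaw (p : ℝ≥0) : MemLp Prod.fst p (pairLaw P W) := by
  have hfst : MeasurePreserving Prod.fst (pairLaw P W) (gaussianReal 0 P) :=
    ⟨measurable_fst, Measure.fst_compProd _ _⟩
  exact (memLp_id_gaussianReal p).comp_measurePreserving hfst

end Channel

section HeldOut

variable {Ω Y : Type*} [MeasurableSpace Ω] [MeasurableSpace Y] {μ : Measure Ω}
  [IsProbabilityMeasure μ] {T : ℕ → Ω → ℝ × Y} {ν : ℝ}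

theorem limsup_measure_heldOutPart_upperConfBound_lt_le {ρ : Measure (ℝ × Y)}
    [IsProbabilityMeasure ρ] (hT : ∀ i, HasLaw (T i) ρ μ) (hindep : iIndepFun T μ) (hν : 0 < ν)
    {U : ∀ L, (Fin (learnLen ν L) → ℝ × Y) → ℝ × Y → ℝ}
    (hU : ∀ L, Measurable (Function.uncurry (U L)))
    (hmem : ∀ L, ∀ᵐ ω ∂μ, MemLp (U L (learnPart ν T L ω)) 2 ρ)
    (hlin : ∀ ε > 0, TendstoInMeasure μ
      (fun L ω => lindebergRatio ρ (U L (learnPart ν T L ω)) (heldOutLen ν L) ε) atTop fun _ => 0)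
    {c : ℝ} (hc : 0 ≤ c) :
    limsup (fun L => μ {ω | upperConfBound c
        (fun i => U L (learnPart ν T L ω) (heldOutPart ν T L ω i)) <
          ρ[U L (learnPart ν T L ω)]}) atTop ≤ ENNReal.ofReal (erfc c / 2) :=
  limsup_measure_upperConfBound_lt_le (tendsto_heldOutLen hν)
    (aemeasurable_learnPart (fun i => (hT i).aemeasurable) ν) (hasLaw_heldOutPart hT hindep ν)
    (indepFun_learnPart_heldOutPart (fun i => (hT i).aemeasurable) hindep ν) hU hmem hlin hc

variable {P : ℝ≥0} {W : Kernel ℝ Y} [IsMarkovKernel W] (A : Learner Y ν)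

theorem limsup_measure_upperConfBound_sq_lt_le (hT : ∀ i, HasLaw (T i) (pairLaw P W) μ)
    (hindep : iIndepFun T μ) (hν : 0 < ν)
    (hmom : ∀ L, ∀ᵐ ω ∂μ,
      MemLp (fun z : ℝ × Y => A.g L (learnPart ν T L ω) z.2) 4 (pairLaw P W))
    (hlin : ∀ ε > 0, TendstoInMeasure μ
      (fun L ω => lindebergRatio (pairLaw P W)
        (fun z => A.g L (learnPart ν T L ω) z.2 ^ 2) (heldOutLen ν L) ε) atTop fun _ => 0)
    {c : ℝ} (hc : 0 ≤ c) :
    limsup (fun L => μ {ω | upperConfBound c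
        (fun i => A.g L (learnPart ν T L ω) (heldOutPart ν T L ω i).2 ^ 2) <
          ∫ z, A.g L (learnPart ν T L ω) z.2 ^ 2 ∂pairLaw P W}) atTop ≤
      ENNReal.ofReal (erfc c / 2) := by
  refine limsup_measure_heldOutPart_upperConfBound_lt_le hT hindep hν
    (U := fun L t z => A.g L t z.2 ^ 2) (fun L => ?_) (fun L => ?_) hlin hc
  · exact ((A.measurable_g L).comp
      (measurable_fst.prodMk measurable_snd.snd)).pow_const 2
  · filter_upwards [hmom L] with ω hω
    simpa only [sq] using memLp_two_mul_of_memLp_four hω hω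

theorem limsup_measure_upperConfBound_neg_sign_mul_lt_le
    (hT : ∀ i, HasLaw (T i) (pairLaw P W) μ) (hindep : iIndepFun T μ) (hν : 0 < ν)
    (hmom : ∀ L, ∀ᵐ ω ∂μ,
      MemLp (fun z : ℝ × Y => A.g L (learnPart ν T L ω) z.2) 4 (pairLaw P W))
    (hlin : ∀ ε > 0, TendstoInMeasure μ
      (fun L ω => lindebergRatio (pairLaw P W)
        (fun z => z.1 * A.g L (learnPart ν T L ω) z.2) (heldOutLen ν L) ε) atTop fun _ => 0)
    {c : ℝ} (hc : 0 ≤ c) :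
    limsup (fun L => μ {ω | upperConfBound c
        (fun i => -Real.sign (A.a L (learnPart ν T L ω)) *
          ((heldOutPart ν T L ω i).1 * A.g L (learnPart ν T L ω) (heldOutPart ν T L ω i).2)) <
          ∫ z, -Real.sign (A.a L (learnPart ν T L ω)) *
            (z.1 * A.g L (learnPart ν T L ω) z.2) ∂pairLaw P W}) atTop ≤
      ENNReal.ofReal (erfc c / 2) := by
  refine limsup_measure_heldOutPart_upperConfBound_lt_le hT hindep hν
    (U := fun L t z => -Real.sign (A.a L t) * (z.1 * A.g L t z.2)) (fun L => ?_) (fun L => ?_)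
    (fun ε hε => ?_) hc
  · exact (measurable_real_sign.comp ((A.measurable_a L).comp measurable_fst)).neg.mul
      (measurable_snd.fst.mul
        ((A.measurable_g L).comp (measurable_fst.prodMk measurable_snd.snd)))
  · filter_upwards [hmom L] with ω hω
    exact (memLp_two_mul_of_memLp_four (memLp_fst_pairLaw P W 4) hω).const_mul _
  · exact tendstoInMeasure_zero_of_nonneg_of_le (fun _ _ => lindebergRatio_nonneg _ _ _ _)
      (fun _ _ => lindebergRatio_const_mul_le _ _ _ _ _) (hlin ε hε)

end HeldOut

theorem mainTheorem5
    {Ω : Type*} [MeasurableSpace Ω] (μ : Measure Ω) [IsProbabilityMeasure μ]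
    {Y : Type*} [MeasurableSpace Y]
    (P : ℝ≥0) (hP : 0 < P) (W : Kernel ℝ Y) [IsMarkovKernel W]
    -- the training data: i.i.d. input-output pairs, the data set of length `L` being the first `L`
    (T : ℕ → Ω → ℝ × Y) (hT : ∀ i, HasLaw (T i) (pairLaw P W) μ) (hindep : iIndepFun T μ)
    (ν : ℝ) (hν0 : 0 < ν) (hν1 : ν < 1)
    (Poe : ℝ) (hPoe0 : 0 < Poe) (hPoe1 : Poe ≤ 1)
    (A : Learner Y ν)
    -- the learnt function has a finite fourth moment
    (hmom : ∀ L, ∀ᵐ ω ∂μ,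
      MemLp (fun z : ℝ × Y => A.g L (learnPart ν T L ω) z.2) 4 (pairLaw P W))
    -- the held-out summands satisfy the Lindeberg condition, in probability
    (hlinY : ∀ ε : ℝ, 0 < ε → TendstoInMeasure μ
      (fun (L : ℕ) (ω : Ω) => lindebergRatio (pairLaw P W)
        (fun z => A.g L (learnPart ν T L ω) z.2 ^ 2) (heldOutLen ν L) ε) atTop (fun _ => 0))
    (hlinXY : ∀ ε : ℝ, 0 < ε → TendstoInMeasure μ
      (fun (L : ℕ) (ω : Ω) => lindebergRatio (pairLaw P W)
        (fun z => z.1 * A.g L (learnPart ν T L ω) z.2) (heldOutLen ν L) ε) atTop (fun _ => 0)) :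
    limsup (fun L : ℕ => μ {ω |
      estRate P Poe (A.g L (learnPart ν T L ω)) (A.a L (learnPart ν T L ω)) (heldOutPart ν T L ω) >
        gmiA P W (A.g L (learnPart ν T L ω)) (A.a L (learnPart ν T L ω))}) atTop
      ≤ ENNReal.ofReal Poe := by
  have hc : 0 ≤ erfcInv Poe := erfcInv_nonneg hPoe0 hPoe1
  have hY := limsup_measure_upperConfBound_sq_lt_le A hT hindep hν0 hmom hlinY hc
  have hXY := limsup_measure_upperConfBound_neg_sign_mul_lt_le A hT hindep hν0 hmom hlinXY hc
  rw [erfc_erfcInv hPoe0 hPoe1] at hY hXY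
  have hsum : ENNReal.ofReal Poe = ENNReal.ofReal (Poe / 2) + ENNReal.ofReal (Poe / 2) := by
    rw [← ENNReal.ofReal_add (half_pos hPoe0).le (half_pos hPoe0).le, add_halves]
  rw [hsum]
  refine le_trans (limsup_le_limsup (.of_forall fun L => ?_)) (limsup_add_le_of_limsup_le hY hXY)
  exact (measure_mono fun ω => upperConfBound_lt_of_gmiA_lt_estRate P W Poe _ _ _).trans
    (measure_union_le _ _)
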